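/- Let $m\ge 1$ and let $\mathrm{Cl}_m$ be the real Clifford algebra generated by $e_1,\dots,e_m$ with $e_ie_j+e_je_i=-2\delta_{ij}$, with the norm $|x|=(\sum_A x_A^2)^{1/2}$ for $x=\sum_A x_Ae_A$. Identify $\mathbb R^{m+1}=\mathbb R\oplus\mathbb R^m$ with the paravectors $x=x_0+\underline x\in\mathrm{Cl}_m$, $\underline x=\sum_{j=1}^m x_je_j$, and put $\operatorname{Re}[x]=x_0$, $\bar x=x_0-\underline x$, and $\mathbb S=\{\underline x:|\underline x|=1\}$. Let $D\subset\mathbb C$ be open and invariant under complex conjugation, and put $\Omega_D=\{u+Jv: u+iv\in D,\ J\in\mathbb S\}$. A stem function on $D$ is a function $F=F_1+iF_2:D\to \mathrm{Cl}_m\otimes\mathbb C$, with $F_1,F_2$ valued in $\mathrm{Cl}_m$, such that $F_1(\bar z)=F_1(z)$ and $F_2(\bar z)=-F_2(z)$. It induces the slice function $f:\Omega_D\to\mathrm{Cl}_m$, $f(u+Jv)=F_1(u+iv)+JF_2(u+iv)$ for $u+iv\in D$, $J\in\mathbb S$. Let $\mathcal S(\Omega_D)$ be the set of slice functions on $\Omega_D$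 and $\mathcal L^p(\Omega_D)=\mathcal S(\Omega_D)\cap L^p(\Omega_D)$, that is, the space of classes in $L^p(\Omega_D)$ ($\mathrm{Cl}_m$-valued, Lebesgue measure $dV$) that contain a slice function, with the $L^p$ norm. Let $\omega_{m-1}$ be the area of $\mathbb S$ (so $\omega_0=2$), and put $$S^{-1}(q,x)=-(q^2-2\operatorname{Re}[x]q+|x|^2)^{-1}(q-\bar x),\qquad K(q,x)=\frac{2\,S^{-1}(q,x)}{\omega_{m-1}|\underline x|^{m-1}},$$ $$T_{\Omega_D}f(q)=-\frac1{2\pi}\int_{\Omega_D}K(q,x)f(x)\,dV(x).$$ Suppose that $\Omega_D$ is bounded, that $\Omega_D\subset\mathbb R^{m+1}\setminus\mathbb R$, and that $\max\{m,2\}<p<\infty$. Then: 1. For each $x\in\Omega_D$, the function $$F(z,x)=F_1(z,x)+iF_2(z,x)=-(z^2-2\operatorname{Re}[x]z+|x|^2)^{-1}(z-\bar x)\in \mathrm{Cl}_m\otimes\mathbb C$$ of $z\in D$ with $z^2-2\operatorname{Re}[x]z+|x|^2\ne0$ is a stem function, and it induces $S^{-1}(\cdot,x)$. 2. For each $f\in\mathcal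 L^p(\Omega_D)$, the integral defining $T_{\Omega_D}f(q)$ converges absolutely for every $q\in\Omega_D$, the integrals in $$H_k(z)=-\frac1{\pi\,\omega_{m-1}}\int_{\Omega_D}\frac{F_k(z,x)}{|\underline x|^{m-1}}f(x)\,dV(x)\qquad(k=1,2)$$ converge absolutely for every $z\in D$, $H=H_1+iH_2$ is a stem function on $D$, and $H$ induces $T_{\Omega_D}f$ (at every point of $\Omega_D$). In particular $T_{\Omega_D}f$ is a slice function. 3. $T_{\Omega_D}$ is a continuous ($\mathbb R$-linear) map of $\mathcal L^p(\Omega_D)$ to itself. -/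

import Mathlib

open MeasureTheory Set
open scoped ENNReal

noncomputable section

namespace SliceClifford

/-! ### The real Clifford algebra with its Euclidean norm -/

/-- The Euclidean space `ℝ^m` of `1`-vectors. -/
abbrev Vec (m : ℕ) : Type := EuclideanSpace ℝ (Fin m)

/-- The negative definite form `v ↦ -|v|²` on `ℝ^m`. -/
def negForm (m : ℕ) : QuadraticForm ℝ (Vec m) :=
  -(LinearMap.BilinMap.toQuadraticMap (innerₗ (Vec m)))

theorem negForm_apply {m : ℕ} (v : Vec m) : negForm m v = -‖v‖ ^ 2 := by
  simp [negForm]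

/-- The real Clifford algebra with generators `e_1, …, e_m` and relations
`e_i e_j + e_j e_i = -2 δ_ij`. -/
abbrev Cl (m : ℕ) : Type := CliffordAlgebra (negForm m)

/-- The inclusion of `1`-vectors into the Clifford algebra. -/
abbrev vec {m : ℕ} : Vec m →ₗ[ℝ] Cl m := CliffordAlgebra.ι (negForm m)

/-- The generator `e_i`. -/
def gen {m : ℕ} (i : Fin m) : Cl m := vec (EuclideanSpace.basisFun (Fin m) ℝ i)

theorem gen_mul_gen_add {m : ℕ} (i j : Fin m) :
    (gen i * gen j + gen j * gen i : Cl m) =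
      algebraMap ℝ (Cl m) (-2 * if i = j then 1 else 0) := by
  have h := CliffordAlgebra.ι_mul_ι_add_swap (Q := negForm m)
    (EuclideanSpace.basisFun (Fin m) ℝ i) (EuclideanSpace.basisFun (Fin m) ℝ j)
  refine h.trans (congrArg _ ?_)
  have hij := (EuclideanSpace.basisFun (Fin m) ℝ).inner_eq_ite i j
  have hji := (EuclideanSpace.basisFun (Fin m) ℝ).inner_eq_ite j i
  simp only [QuadraticMap.polar, negForm_apply, norm_add_sq_real, hij]
  ring

/-- The basis `(e_A)` of the Clifford algebra, indexed by the subsets `A` of `{1, …, m}`: it is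
the image of the basis of the exterior algebra, and `basis_apply` identifies its members with the
ordered products of generators. -/
def basis (m : ℕ) : Module.Basis (Finset (Fin m)) ℝ (Cl m) :=
  (Module.Basis.ExteriorAlgebra (EuclideanSpace.basisFun (Fin m) ℝ).toBasis).map
    (CliffordAlgebra.equivExterior (negForm m)).symm

theorem contractLeft_prod_eq_zero {m : ℕ} {Q : QuadraticForm ℝ (Vec m)}
    (d : Module.Dual ℝ (Vec m)) (l : List (Vec m)) (h : ∀ v ∈ l, d v = 0) :
    CliffordAlgebra.contractLeft (Q := Q) d (l.map (CliffordAlgebra.ι Q)).prod = 0 := by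
  induction l with
  | nil => simp
  | cons a l ih =>
    rw [List.map_cons, List.prod_cons, CliffordAlgebra.contractLeft_ι_mul,
      ih fun v hv => h v (List.mem_cons_of_mem _ hv), h a List.mem_cons_self]
    simp

theorem changeForm_prod {m : ℕ} {Q Q' : QuadraticForm ℝ (Vec m)}
    {B : LinearMap.BilinForm ℝ (Vec m)} (hB : B.toQuadraticMap = Q' - Q) (l : List (Vec m))
    (h : l.Pairwise fun v w => B v w = 0) :
    CliffordAlgebra.changeForm hB (l.map (CliffordAlgebra.ι Q)).prod =
      (l.map (CliffordAlgebra.ι Q')).prod := by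
  induction l with
  | nil => simp
  | cons a l ih =>
    rw [List.pairwise_cons] at h
    rw [List.map_cons, List.prod_cons, CliffordAlgebra.changeForm_ι_mul, ih h.2,
      contractLeft_prod_eq_zero _ _ h.1]
    simp

/-- `e_A = e_{i_1} ⋯ e_{i_k}` for `A = {i_1 < ⋯ < i_k}`. -/
theorem basis_apply {m : ℕ} (A : Finset (Fin m)) :
    basis m A = ((A.sort (· ≤ ·)).map gen).prod := by
  have h1 : Module.Basis.ExteriorAlgebra (EuclideanSpace.basisFun (Fin m) ℝ).toBasis A =
      (((A.sort (· ≤ ·)).map (EuclideanSpace.basisFun (Fin m) ℝ)).map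
        (CliffordAlgebra.ι (0 : QuadraticForm ℝ (Vec m)))).prod := by
    rw [ExteriorAlgebra.basis_apply_ofCard (n := A.card) _ rfl, ExteriorAlgebra.ιMulti_family,
      ExteriorAlgebra.ιMulti_apply, List.map_map]
    congr 1
    refine List.ext_getElem (by simp) fun i h1 h2 => ?_
    simp [Set.powersetCard.ofFinEmbEquiv_symm_apply, Finset.orderEmbOfFin_apply]
  rw [basis, Module.Basis.map_apply, h1, CliffordAlgebra.equivExterior,
    CliffordAlgebra.changeFormEquiv_symm, CliffordAlgebra.changeFormEquiv_apply,
    changeForm_prod]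
  · rw [List.map_map]; rfl
  · rw [List.pairwise_map]
    refine (Finset.sort_nodup A (· ≤ ·)).imp fun {i j} hij => ?_
    have h := (EuclideanSpace.basisFun (Fin m) ℝ).inner_eq_zero hij
    simp only [neg_neg, negForm, LinearMap.neg_apply, QuadraticMap.associated_apply,
      LinearMap.BilinMap.toQuadraticMap_apply, innerₗ_apply_apply, real_inner_self_eq_norm_sq,
      norm_add_sq_real, h]
    have h0 (a b : ℝ) : a + 2 * 0 + b - a - b = 0 := by ring
    rw [h0, smul_zero, neg_zero]

/-- The coordinates `(x_A)` of a Clifford number, as a point of Euclidean space. -/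
def coords (m : ℕ) : Cl m →ₗ[ℝ] EuclideanSpace ℝ (Finset (Fin m)) :=
  ((basis m).equivFun.trans (WithLp.linearEquiv 2 ℝ (Finset (Fin m) → ℝ)).symm).toLinearMap

theorem coords_injective (m : ℕ) : Function.Injective (coords m) :=
  ((basis m).equivFun.trans (WithLp.linearEquiv 2 ℝ (Finset (Fin m) → ℝ)).symm).injective

instance instNormedAddCommGroup (m : ℕ) : NormedAddCommGroup (Cl m) :=
  NormedAddCommGroup.induced (Cl m) (EuclideanSpace ℝ (Finset (Fin m))) (coords m)
    (coords_injective m)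

instance instNormedSpace (m : ℕ) : NormedSpace ℝ (Cl m) :=
  NormedSpace.induced ℝ (Cl m) (EuclideanSpace ℝ (Finset (Fin m))) (coords m)

/-- `|x| = (∑_A x_A²)^{1/2}` for `x = ∑_A x_A e_A`. -/
theorem norm_eq {m : ℕ} (x : Cl m) : ‖x‖ = √(∑ A, (basis m).repr x A ^ 2) := by
  change ‖coords m x‖ = _
  rw [EuclideanSpace.norm_eq]
  simp [coords]

instance instFinite (m : ℕ) : Module.Finite ℝ (Cl m) := Module.Finite.of_basis (basis m)

instance instComplete (m : ℕ) : CompleteSpace (Cl m) := FiniteDimensional.complete ℝ (Cl m)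

/-! ### Paravectors and slice functions -/

/-- The space `ℝ^{m+1} = ℝ ⊕ ℝ^m` of paravectors `x = x_0 + x̲`, stored as `(x_0, x̲)`. Its topology
and its measure `volume` are the usual topology and Lebesgue measure of `ℝ^{m+1}`; the Euclidean
length is `normSq` below, not the norm that the product type carries. -/
abbrev Para (m : ℕ) : Type := ℝ × Vec m

/-- The square `|x|² = x_0² + |x̲|²` of the Euclidean length of a paravector. -/
def normSq {m : ℕ} (x : Para m) : ℝ := x.1 ^ 2 + ‖x.2‖ ^ 2

/-- The paravector `x_0 + x̲` as a Clifford number. -/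
def para {m : ℕ} (x : Para m) : Cl m := algebraMap ℝ (Cl m) x.1 + vec x.2

/-- The sphere `𝕊` of the unit `1`-vectors. -/
abbrev unitSphere (m : ℕ) : Set (Vec m) := Metric.sphere 0 1

/-- `Φ_J (u + i v) = u + J v`. -/
def slicePoint {m : ℕ} (J : Vec m) (z : ℂ) : Para m := (z.re, z.im • J)

/-- The axially symmetric set `Ω_D = ⋃_{J ∈ 𝕊} Φ_J(D)`. -/
def Omega (m : ℕ) (D : Set ℂ) : Set (Para m) := ⋃ J ∈ unitSphere m, slicePoint J '' D

/-- `F_1 + i F_2`, with Clifford-valued `F_1` and `F_2`, is a stem function on `D`: its value at the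
conjugate of `z` is `F_1(z) - i F_2(z)`. -/
structure IsStem {m : ℕ} (D : Set ℂ) (F₁ F₂ : ℂ → Cl m) : Prop where
  even : ∀ z ∈ D, F₁ (starRingEnd ℂ z) = F₁ z
  odd : ∀ z ∈ D, F₂ (starRingEnd ℂ z) = -F₂ z

/-- On `Ω_D`, the function `f` is given by `f(u + J v) = F_1(u + i v) + J F_2(u + i v)`. -/
def Induces {m : ℕ} (D : Set ℂ) (F₁ F₂ : ℂ → Cl m) (f : Para m → Cl m) : Prop :=
  ∀ z ∈ D, ∀ J ∈ unitSphere m, f (slicePoint J z) = F₁ z + vec J * F₂ z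

/-- `f` is (on `Ω_D`) a left slice function; its values outside `Ω_D` do not matter. -/
def IsSlice {m : ℕ} (D : Set ℂ) (f : Para m → Cl m) : Prop :=
  ∃ F₁ F₂ : ℂ → Cl m, IsStem D F₁ F₂ ∧ Induces D F₁ F₂ f

/-- The space `𝓛^p(Ω_D) = 𝓢(Ω_D) ∩ L^p(Ω_D)`: the classes in `L^p(Ω_D)` of slice functions,
with the `L^p` norm. -/
def sliceLp (m : ℕ) (D : Set ℂ) (p : ℝ≥0∞) :
    Submodule ℝ (Lp (Cl m) p (volume.restrict (Omega m D))) where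
  carrier := {f | ∃ g : Para m → Cl m, IsSlice D g ∧ f =ᵐ[volume.restrict (Omega m D)] g}
  zero_mem' := ⟨0, ⟨0, 0, ⟨by simp, by simp⟩, by simp [Induces]⟩, Lp.coeFn_zero _ _ _⟩
  add_mem' := by
    rintro f f' ⟨g, ⟨F₁, F₂, h, hg⟩, hf⟩ ⟨g', ⟨F₁', F₂', h', hg'⟩, hf'⟩
    refine ⟨g + g', ⟨F₁ + F₁', F₂ + F₂', ⟨fun z hz => ?_, fun z hz => ?_⟩,
      fun z hz J hJ => ?_⟩, (Lp.coeFn_add f f').trans (hf.add hf')⟩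
    · simp [h.even z hz, h'.even z hz]
    · simp [h.odd z hz, h'.odd z hz, add_comm]
    · simp [hg z hz J hJ, hg' z hz J hJ, mul_add, add_add_add_comm]
  smul_mem' := by
    rintro c f ⟨g, ⟨F₁, F₂, h, hg⟩, hf⟩
    refine ⟨c • g, ⟨c • F₁, c • F₂, ⟨fun z hz => ?_, fun z hz => ?_⟩,
      fun z hz J hJ => ?_⟩, (Lp.coeFn_smul c f).trans (hf.const_smul c)⟩
    · simp [h.even z hz]
    · simp [h.odd z hz]
    · simp [hg z hz J hJ]

/-! ### The kernels and the Teodorescu transform -/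

/-- The area of the unit sphere of `ℝ^m` (two points of mass one if `m = 1`). -/
def sphereArea (m : ℕ) : ℝ := (volume : Measure (Vec m)).toSphere.real univ

/-- The slice Cauchy kernel `S⁻¹(q, x) = -(q² - 2 Re[x] q + |x|²)⁻¹ (q - x̄)`, where `x̄` is the
Clifford conjugate. The first factor is the inverse in the Clifford algebra, read as `0` where
`q² - 2 Re[x] q + |x|²` is not invertible. -/
def cauchyKernel {m : ℕ} (q x : Para m) : Cl m :=
  -(Ring.inverse (para q ^ 2 - (2 * x.1) • para q + algebraMap ℝ (Cl m) (normSq x)) *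
    (para q - star (para x)))

/-- `K(q, x) = 2 S⁻¹(q, x) / (ω_{m-1} |x̲|^{m-1})`. -/
def kernel {m : ℕ} (q x : Para m) : Cl m :=
  (2 / (sphereArea m * ‖x.2‖ ^ (m - 1))) • cauchyKernel q x

/-- The Teodorescu transform `T_{Ω_D} f (q) = -(2π)⁻¹ ∫_{Ω_D} K(q, x) f(x) dV(x)`. -/
def teodorescu {m : ℕ} (D : Set ℂ) (f : Para m → Cl m) (q : Para m) : Cl m :=
  -(1 / (2 * Real.pi)) • ∫ x in Omega m D, kernel q x * f x

/-- The complex number `z² - 2 Re[x] z + |x|²`. -/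
def charPoly {m : ℕ} (z : ℂ) (x : Para m) : ℂ := z ^ 2 - 2 * (x.1 : ℂ) * z + (normSq x : ℂ)

/-- The first component of `-(z² - 2 Re[x] z + |x|²)⁻¹ (z - x̄)`, an element of `ℂ ⊗ Cl_m`. -/
def kernelStem₁ {m : ℕ} (z : ℂ) (x : Para m) : Cl m :=
  -(algebraMap ℝ (Cl m) ((charPoly z x)⁻¹ * z).re - ((charPoly z x)⁻¹).re • star (para x))

/-- The second component of `-(z² - 2 Re[x] z + |x|²)⁻¹ (z - x̄)`. -/
def kernelStem₂ {m : ℕ} (z : ℂ) (x : Para m) : Cl m :=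
  -(algebraMap ℝ (Cl m) ((charPoly z x)⁻¹ * z).im - ((charPoly z x)⁻¹).im • star (para x))

/-- `H(z) = -(π ω_{m-1})⁻¹ ∫_{Ω_D} |x̲|^{1-m} F(z, x) f(x) dV(x)` for a component `F` of the stem
function of the slice Cauchy kernel. -/
def stemTransform {m : ℕ} (F : ℂ → Para m → Cl m) (D : Set ℂ) (f : Para m → Cl m) (z : ℂ) :
    Cl m :=
  -(1 / (Real.pi * sphereArea m)) •
    ∫ x in Omega m D, (‖x.2‖ ^ (m - 1))⁻¹ • (F z x * f x)

end SliceClifford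

end

namespace SliceClifford

/-! ### Multiplication of Clifford numbers -/

/-! Algebra: for a unit vector `J` one has `J² = -1`, so `u + iv ↦ u + Jv` is a real algebra
homomorphism from ℂ to the Clifford algebra. It turns the complex formula for the stem function of
the kernel into the Clifford formula (`cauchyKernel_slicePoint`). Once the integrals converge, `J`
can be pulled out of them, so the transform is induced by the integrated stem function
(`teodorescu_slicePoint`).

Size: put `ζ = x₀ + i|x̲|` and reflect `z` to `z'` in the upper half plane. The polynomial has
modulus `|z' - ζ| |z' - ζ̄|`, and the second factor controls the numerator. Hence the stem
components are `O(|z' - ζ|⁻¹)`, which is at most `|u - x₀|^(-a) ||v| - |x̲||^(-b)` whenever `a + b =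
1` (`norm_inv_charPoly_mul_le`).

Hölder's inequality needs the power `s = p/(p-1)` of this bound times `|x̲|^(1-m)`. In polar
coordinates the density `r^(m-1)` cancels all of `|x̲|^(-(m-1)s)` except `r^(-c)`, with `c =
(m-1)/(p-1)`. One dimensional integrals remain, and `a`, `b` can be chosen to make them finite
because `p > m` gives `c < 1` and `p > 2` gives `s < 2` (`exists_lintegral_weight_le`).

The outcome is `|Tf(q)| ≤ A |q̲|^(-(m-1)/p) ‖f‖_p`. This gives convergence at every point off the
real axis, and the `p`-th power of the right side is locally integrable, which gives continuity on
`L^p`. -/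

/-- The Euclidean coordinate norm comes with no submultiplicativity here; boundedness of a bilinear
map in finite dimension supplies a constant instead. -/
theorem exists_norm_mul_le (m : ℕ) :
    ∃ C : ℝ, 0 < C ∧ ∀ a b : Cl m, ‖a * b‖ ≤ C * (‖a‖ * ‖b‖) := by
  let L : Cl m →L[ℝ] Cl m →L[ℝ] Cl m := LinearMap.toContinuousLinearMap
    ((LinearMap.toContinuousLinearMap (𝕜 := ℝ) (E := Cl m) (F' := Cl m)).toLinearMap ∘ₗ
      LinearMap.mul ℝ (Cl m))
  refine ⟨‖L‖ + 1, by positivity, fun a b => ?_⟩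
  have h : ‖a * b‖ ≤ ‖L‖ * ‖a‖ * ‖b‖ := L.le_opNorm₂ a b
  nlinarith [mul_nonneg (norm_nonneg a) (norm_nonneg b)]

instance instContinuousMul (m : ℕ) : ContinuousMul (Cl m) where
  continuous_mul := by
    let L : Cl m →L[ℝ] Cl m →L[ℝ] Cl m := LinearMap.toContinuousLinearMap
      ((LinearMap.toContinuousLinearMap (𝕜 := ℝ) (E := Cl m) (F' := Cl m)).toLinearMap ∘ₗ
        LinearMap.mul ℝ (Cl m))
    exact (L.continuous.comp continuous_fst).clm_apply continuous_snd

theorem continuous_vec (m : ℕ) : Continuous (vec : Vec m → Cl m) :=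
  LinearMap.continuous_of_finiteDimensional _

/-! ### The stem function of the Cauchy kernel -/

theorem vec_mul_self {m : ℕ} {J : Vec m} (hJ : J ∈ unitSphere m) : (vec J * vec J : Cl m) = -1 := by
  rw [CliffordAlgebra.ι_sq_scalar, negForm_apply, mem_sphere_zero_iff_norm.1 hJ]
  simp

theorem star_para {m : ℕ} (x : Para m) : star (para x) = algebraMap ℝ (Cl m) x.1 - vec x.2 := by
  rw [para, star_add, CliffordAlgebra.star_algebraMap, CliffordAlgebra.star_ι, sub_eq_add_neg]

/-- Both conventions for inverting zero agree, so the kernel formula below also holds at the zeros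
of `charPoly`. -/
theorem map_ringInverse {K R : Type*} [Field K] [Ring R] [Nontrivial R] (φ : K →+* R) (c : K) :
    Ring.inverse (φ c) = φ c⁻¹ := by
  rcases eq_or_ne c 0 with rfl | hc
  · simp
  · have h : (Units.mk (φ c) (φ c⁻¹) (by rw [← map_mul, mul_inv_cancel₀ hc, map_one])
      (by rw [← map_mul, inv_mul_cancel₀ hc, map_one]) : Rˣ) = φ c := rfl
    rw [← h, Ring.inverse_unit]
    rfl

/-- The homomorphism `φ` with `i ↦ J` carries `z` to the slice point and `charPoly z x` to the
Clifford polynomial. The conjugate of `x` need not commute with `J`, but it stands on the right, so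
`J` still comes out on the left. -/
theorem cauchyKernel_slicePoint {m : ℕ} {J : Vec m} (hJ : J ∈ unitSphere m) (z : ℂ) (x : Para m) :
    cauchyKernel (slicePoint J z) x = kernelStem₁ z x + vec J * kernelStem₂ z x := by
  let φ : ℂ →ₐ[ℝ] Cl m := Complex.liftAux (vec J) (vec_mul_self hJ)
  have hφ (c : ℂ) : φ c = algebraMap ℝ (Cl m) c.re + vec J * algebraMap ℝ (Cl m) c.im := by
    rw [Complex.liftAux_apply, ← Algebra.commutes, Algebra.smul_def]
  have hz : para (slicePoint J z) = φ z := by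
    rw [Complex.liftAux_apply, para, slicePoint, map_smul]
  have hr (r : ℝ) : φ (r : ℂ) = algebraMap ℝ (Cl m) r := φ.commutes r
  have hc : para (slicePoint J z) ^ 2 - (2 * x.1) • para (slicePoint J z) +
      algebraMap ℝ (Cl m) (normSq x) = φ (charPoly z x) := by
    rw [hz, charPoly, map_add, map_sub, map_pow, hr, ← hr, ← map_smul, Complex.real_smul, hr]
    push_cast
    rfl
  have hi : Ring.inverse (φ (charPoly z x)) = φ (charPoly z x)⁻¹ := map_ringInverse φ.toRingHom _
  rw [cauchyKernel, hc, hi, hz, mul_sub, ← map_mul, hφ, hφ, kernelStem₁, kernelStem₂,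
    Algebra.smul_def, Algebra.smul_def]
  noncomm_ring

theorem charPoly_conj {m : ℕ} (z : ℂ) (x : Para m) :
    charPoly (starRingEnd ℂ z) x = starRingEnd ℂ (charPoly z x) := by
  simp [charPoly, map_ofNat]

theorem kernelStem₁_conj {m : ℕ} (z : ℂ) (x : Para m) :
    kernelStem₁ (starRingEnd ℂ z) x = kernelStem₁ z x := by
  rw [kernelStem₁, charPoly_conj, ← map_inv₀, ← map_mul, Complex.conj_re, Complex.conj_re]
  rfl

theorem kernelStem₂_conj {m : ℕ} (z : ℂ) (x : Para m) :
    kernelStem₂ (starRingEnd ℂ z) x = -kernelStem₂ z x := by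
  rw [kernelStem₂, charPoly_conj, ← map_inv₀, ← map_mul, Complex.conj_im, Complex.conj_im,
    kernelStem₂, map_neg, neg_smul]
  abel

theorem isStem_kernelStem {m : ℕ} (D : Set ℂ) (x : Para m) :
    IsStem D (fun z => kernelStem₁ z x) (fun z => kernelStem₂ z x) :=
  ⟨fun z _ => kernelStem₁_conj z x, fun z _ => kernelStem₂_conj z x⟩

theorem induces_cauchyKernel {m : ℕ} (D : Set ℂ) (x : Para m) :
    Induces D (fun z => kernelStem₁ z x) (fun z => kernelStem₂ z x)
      (fun q => cauchyKernel q x) :=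
  fun z _ _ hJ => cauchyKernel_slicePoint hJ z x

/-! ### Size of the stem function -/

/-- The point of the closed upper half plane that represents the sphere of `x`. -/
noncomputable def halfPlane {m : ℕ} (x : Para m) : ℂ := ⟨x.1, ‖x.2‖⟩

theorem charPoly_eq_mul {m : ℕ} (z : ℂ) (x : Para m) :
    charPoly z x = (z - halfPlane x) * (z - starRingEnd ℂ (halfPlane x)) := by
  apply Complex.ext <;> simp [charPoly, halfPlane, normSq, pow_two] <;> ring

/-- The polynomial has real coefficients, so conjugating `z` preserves its modulus. After reflection
into the upper half plane the first factor is the only small one. -/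
theorem norm_charPoly {m : ℕ} (z : ℂ) (x : Para m) :
    ‖charPoly z x‖ = ‖(⟨z.re, |z.im|⟩ : ℂ) - halfPlane x‖ *
      ‖(⟨z.re, |z.im|⟩ : ℂ) - starRingEnd ℂ (halfPlane x)‖ := by
  rw [← norm_mul, ← charPoly_eq_mul]
  rcases le_total 0 z.im with h | h
  · rw [abs_of_nonneg h]
  · have : (⟨z.re, |z.im|⟩ : ℂ) = starRingEnd ℂ z := by
      apply Complex.ext <;> simp [abs_of_nonpos h]
    rw [this, charPoly_conj, RCLike.norm_conj]

/-- The factor `|z' - ζ̄|` dominates both summands of the numerator, whence the 2. The other factor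
dominates the real and the imaginary distance, hence their weighted geometric mean, in which the
variables separate. -/
theorem norm_inv_charPoly_mul_le {m : ℕ} {a b : ℝ} (ha : 0 < a) (hb : 0 < b) (hab : a + b = 1)
    (z : ℂ) (x : Para m) :
    ‖(charPoly z x)⁻¹‖ * (‖z - x.1‖ + ‖x.2‖) *
      (|z.re - x.1| ^ a * |(|z.im|) - ‖x.2‖| ^ b) ≤ 2 := by
  rcases eq_or_ne (charPoly z x) 0 with hc | hc
  · simp [hc]
  set z' : ℂ := ⟨z.re, |z.im|⟩ with hz'
  have hδ : |z.re - x.1| ^ a * |(|z.im|) - ‖x.2‖| ^ b ≤ ‖z' - halfPlane x‖ := by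
    have h1 : |z.re - x.1| ≤ ‖z' - halfPlane x‖ := Complex.abs_re_le_norm (z' - halfPlane x)
    have h2 : |(|z.im|) - ‖x.2‖| ≤ ‖z' - halfPlane x‖ := Complex.abs_im_le_norm (z' - halfPlane x)
    calc _ ≤ ‖z' - halfPlane x‖ ^ a * ‖z' - halfPlane x‖ ^ b := by gcongr
      _ = _ := by rw [← Real.rpow_add_of_nonneg (norm_nonneg _) ha.le hb.le, hab, Real.rpow_one]
  have hρ1 : ‖z - x.1‖ ≤ ‖z' - starRingEnd ℂ (halfPlane x)‖ := by
    rw [← sq_le_sq₀ (norm_nonneg _) (norm_nonneg _), Complex.sq_norm, Complex.sq_norm,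
      Complex.normSq_apply, Complex.normSq_apply]
    simp only [hz', halfPlane, Complex.sub_re, Complex.sub_im, Complex.ofReal_re,
      Complex.ofReal_im, Complex.conj_re, Complex.conj_im]
    nlinarith [abs_nonneg z.im, norm_nonneg x.2, abs_mul_abs_self z.im,
      mul_nonneg (abs_nonneg z.im) (norm_nonneg x.2)]
  have hρ2 : ‖x.2‖ ≤ ‖z' - starRingEnd ℂ (halfPlane x)‖ := by
    refine le_trans ?_ (Complex.abs_im_le_norm _)
    simp only [hz', halfPlane, Complex.sub_im, Complex.conj_im, sub_neg_eq_add]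
    exact le_trans (by linarith [abs_nonneg z.im]) (le_abs_self _)
  rw [norm_inv, mul_assoc, inv_mul_le_iff₀ (norm_pos_iff.2 hc), norm_charPoly]
  calc _ ≤ (‖z' - starRingEnd ℂ (halfPlane x)‖ + ‖z' - starRingEnd ℂ (halfPlane x)‖) *
        ‖z' - halfPlane x‖ := by gcongr
    _ = _ := by ring

/-- Regrouping `z - x̄` as `(z - x₀) + x̲` exposes the numerator `|z - x₀| + |x̲|` that the
estimates use. -/
theorem kernelStem₁_eq {m : ℕ} (z : ℂ) (x : Para m) :
    kernelStem₁ z x = -(((charPoly z x)⁻¹ * (z - x.1)).re • (1 : Cl m) +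
      ((charPoly z x)⁻¹).re • vec x.2) := by
  rw [kernelStem₁, star_para, smul_sub, Algebra.algebraMap_eq_smul_one,
    Algebra.algebraMap_eq_smul_one, smul_smul, mul_sub, Complex.sub_re, Complex.re_mul_ofReal,
    sub_smul]
  abel

theorem kernelStem₂_eq {m : ℕ} (z : ℂ) (x : Para m) :
    kernelStem₂ z x = -(((charPoly z x)⁻¹ * (z - x.1)).im • (1 : Cl m) +
      ((charPoly z x)⁻¹).im • vec x.2) := by
  rw [kernelStem₂, star_para, smul_sub, Algebra.algebraMap_eq_smul_one,
    Algebra.algebraMap_eq_smul_one, smul_smul, mul_sub, Complex.sub_im, Complex.im_mul_ofReal,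
    sub_smul]
  abel

theorem exists_norm_kernelStem_le (m : ℕ) :
    ∃ A : ℝ, 0 < A ∧ ∀ (z : ℂ) (x : Para m),
      ‖kernelStem₁ z x‖ ≤ A * (‖(charPoly z x)⁻¹‖ * (‖z - x.1‖ + ‖x.2‖)) ∧
      ‖kernelStem₂ z x‖ ≤ A * (‖(charPoly z x)⁻¹‖ * (‖z - x.1‖ + ‖x.2‖)) := by
  let L : Vec m →L[ℝ] Cl m := LinearMap.toContinuousLinearMap vec
  have key (A : ℝ) (hA : A = ‖(1 : Cl m)‖ + ‖L‖ + 1) (c d : ℂ) (r s : ℝ) (hr : |r| ≤ ‖c * d‖)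
      (hs : |s| ≤ ‖c‖) (v : Vec m) :
      ‖-(r • (1 : Cl m) + s • vec v)‖ ≤ A * (‖c‖ * (‖d‖ + ‖v‖)) := by
    have hv : ‖(vec v : Cl m)‖ ≤ ‖L‖ * ‖v‖ := L.le_opNorm v
    rw [norm_mul] at hr
    calc ‖-(r • (1 : Cl m) + s • vec v)‖ ≤ ‖r • (1 : Cl m)‖ + ‖s • (vec v : Cl m)‖ := by
          rw [norm_neg]; exact norm_add_le _ _
      _ ≤ ‖c‖ * ‖d‖ * A + ‖c‖ * (A * ‖v‖) := by
          rw [norm_smul, norm_smul, Real.norm_eq_abs, Real.norm_eq_abs]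
          have h1 : ‖(1 : Cl m)‖ ≤ A := by rw [hA]; linarith [norm_nonneg L]
          have h2 : ‖(vec v : Cl m)‖ ≤ A * ‖v‖ :=
            hv.trans (mul_le_mul_of_nonneg_right
              (by rw [hA]; linarith [norm_nonneg (1 : Cl m)]) (norm_nonneg v))
          gcongr
      _ = _ := by ring
  refine ⟨‖(1 : Cl m)‖ + ‖L‖ + 1, by positivity, fun z x => ⟨?_, ?_⟩⟩
  · rw [kernelStem₁_eq]
    exact key _ rfl _ _ _ _ (Complex.abs_re_le_norm _) (Complex.abs_re_le_norm _) _
  · rw [kernelStem₂_eq]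
    exact key _ rfl _ _ _ _ (Complex.abs_im_le_norm _) (Complex.abs_im_le_norm _) _

/-- Negative powers of zero are `⊤` in `ℝ≥0∞`, so dividing the product bound needs no exception on
the singular set. -/
theorem enorm_le_of_norm_mul_le {E : Type*} [SeminormedAddCommGroup E] {k : E} {s t a b B : ℝ}
    (ha : 0 < a) (hb : 0 < b) (hB : 0 < B) (h : ‖k‖ * (|s| ^ a * |t| ^ b) ≤ B) :
    ‖k‖ₑ ≤ ENNReal.ofReal B * (‖s‖ₑ ^ (-a) * ‖t‖ₑ ^ (-b)) := by
  have h0 (r c : ℝ) (hc : 0 < c) : ‖r‖ₑ ^ c = ENNReal.ofReal (|r| ^ c) := by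
    rw [← ENNReal.ofReal_rpow_of_nonneg (abs_nonneg r) hc.le, Real.enorm_eq_ofReal_abs]
  have htop (r c : ℝ) (hc : 0 < c) : ‖r‖ₑ ^ c ≠ ⊤ := ENNReal.rpow_ne_top_of_nonneg hc.le (by simp)
  have hB' : ENNReal.ofReal B ≠ 0 := by simpa using hB
  rw [ENNReal.rpow_neg, ENNReal.rpow_neg, ← ENNReal.mul_inv (.inr (htop t b hb))
    (.inl (htop s a ha)), ← div_eq_mul_inv, ENNReal.le_div_iff_mul_le (.inr hB')
    (.inl (ENNReal.mul_ne_top (htop s a ha) (htop t b hb))), h0 s a ha, h0 t b hb,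
    ← ofReal_norm, ← ENNReal.ofReal_mul (by positivity),
    ← ENNReal.ofReal_mul (by positivity)]
  exact ENNReal.ofReal_le_ofReal h

theorem exists_enorm_kernelStem_le (m : ℕ) {a b : ℝ} (ha : 0 < a) (hb : 0 < b) (hab : a + b = 1) :
    ∃ B : ℝ≥0∞, B ≠ ⊤ ∧ ∀ (z : ℂ) (x : Para m),
      ‖kernelStem₁ z x‖ₑ ≤ B * (‖z.re - x.1‖ₑ ^ (-a) * ‖|z.im| - ‖x.2‖‖ₑ ^ (-b)) ∧
      ‖kernelStem₂ z x‖ₑ ≤ B * (‖z.re - x.1‖ₑ ^ (-a) * ‖|z.im| - ‖x.2‖‖ₑ ^ (-b)) := by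
  obtain ⟨A, hA, h⟩ := exists_norm_kernelStem_le m
  have key (k : Cl m) (z : ℂ) (x : Para m)
      (hk : ‖k‖ ≤ A * (‖(charPoly z x)⁻¹‖ * (‖z - x.1‖ + ‖x.2‖))) :
      ‖k‖ * (|z.re - x.1| ^ a * |(|z.im|) - ‖x.2‖| ^ b) ≤ A * 2 :=
    calc _ ≤ A * (‖(charPoly z x)⁻¹‖ * (‖z - x.1‖ + ‖x.2‖)) *
          (|z.re - x.1| ^ a * |(|z.im|) - ‖x.2‖| ^ b) := by gcongr
      _ ≤ _ := by
        rw [mul_assoc]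
        exact mul_le_mul_of_nonneg_left (norm_inv_charPoly_mul_le ha hb hab z x) hA.le
  exact ⟨ENNReal.ofReal (A * 2), ENNReal.ofReal_ne_top, fun z x =>
    ⟨enorm_le_of_norm_mul_le ha hb (by positivity) (key _ _ _ (h z x).1),
      enorm_le_of_norm_mul_le ha hb (by positivity) (key _ _ _ (h z x).2)⟩⟩

end SliceClifford

/-! ### Integrals of radial functions -/

/-- Polar coordinates: off the null point 0, the measure is the product of the sphere measure and
`r^(n-1) dr`. -/
theorem MeasureTheory.lintegral_fun_norm_addHaar {E : Type*} [NormedAddCommGroup E]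
    [NormedSpace ℝ E] [Nontrivial E] [FiniteDimensional ℝ E] [MeasurableSpace E] [BorelSpace E]
    (μ : Measure E) [μ.IsAddHaarMeasure] {f : ℝ → ℝ≥0∞} (hf : Measurable f) :
    ∫⁻ x, f ‖x‖ ∂μ = μ.toSphere univ *
      ∫⁻ y in Ioi (0 : ℝ), ENNReal.ofReal (y ^ (Module.finrank ℝ E - 1)) * f y :=
  calc
    ∫⁻ x, f ‖x‖ ∂μ = ∫⁻ x : ({(0)}ᶜ : Set E), f ‖x.1‖ ∂(μ.comap (↑)) := by
      rw [lintegral_subtype_comap (measurableSet_singleton _).compl fun x ↦ f ‖x‖,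
        restrict_compl_singleton]
    _ = ∫⁻ x, f x.2 ∂μ.toSphere.prod (.volumeIoiPow (Module.finrank ℝ E - 1)) := by
      simpa using μ.measurePreserving_homeomorphUnitSphereProd.lintegral_comp_emb
        (Homeomorph.measurableEmbedding _) (f ∘ Subtype.val ∘ Prod.snd)
    _ = μ.toSphere univ *
        ∫⁻ x : Ioi (0 : ℝ), f x ∂.volumeIoiPow (Module.finrank ℝ E - 1) := by
      have h := lintegral_prod_mul (μ := μ.toSphere)
        (ν := .volumeIoiPow (Module.finrank ℝ E - 1)) (f := fun _ => 1) (g := fun x => f x)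
        aemeasurable_const (hf.comp measurable_subtype_coe).aemeasurable
      simpa using h
    _ = _ := by
      rw [← lintegral_subtype_comap measurableSet_Ioi]
      exact congrArg _ (lintegral_withDensity_eq_lintegral_mul _
        (measurable_subtype_coe.pow_const _).ennreal_ofReal (hf.comp measurable_subtype_coe))

theorem lintegral_ball_enorm_rpow_lt_top {α : ℝ} (hα : α < 1) (R : ℝ) :
    ∫⁻ x in Metric.ball (0 : ℝ) R, ‖x‖ₑ ^ (-α) < ⊤ := by
  rcases le_or_gt R 0 with hR | hR
  · simp [Metric.ball_eq_empty.2 hR]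
  have h : IntegrableOn (fun x : ℝ => ‖x‖ ^ (-α)) (Metric.ball 0 R) := by
    rw [integrableOn_fun_norm_addHaar volume (f := fun y : ℝ => y ^ (-α))]
    simpa using (intervalIntegral.integrableOn_Ioo_rpow_iff hR).2 (by linarith)
  refine lt_of_le_of_lt (le_of_eq (lintegral_congr_ae ?_)) h.2
  -- The extended and the real power may differ at 0, so that point is discarded.
  filter_upwards [ae_restrict_of_ae (Measure.ae_ne volume 0)] with x hx
  rw [Real.enorm_of_nonneg (r := ‖x‖ ^ (-α)) (by positivity),
    ← ENNReal.ofReal_rpow_of_pos (norm_pos_iff.2 hx), ofReal_norm]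

/-- The map `x ↦ v - x` preserves the measure and sends the ball into the doubled one, so the bound
is uniform in `v`. -/
theorem lintegral_ball_enorm_sub_rpow_le (β : ℝ) {R v : ℝ} (hv : |v| < R) :
    ∫⁻ x in Metric.ball (0 : ℝ) R, ‖v - x‖ₑ ^ (-β) ≤
      ∫⁻ x in Metric.ball (0 : ℝ) (2 * R), ‖x‖ₑ ^ (-β) := by
  have h := (Measure.measurePreserving_sub_left (volume : Measure ℝ) v).setLIntegral_comp_preimage
    (s := Metric.ball 0 (2 * R)) (f := fun x => ‖x‖ₑ ^ (-β)) Metric.isOpen_ball.measurableSet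
    (by fun_prop)
  rw [← h]
  refine lintegral_mono_set fun x hx => ?_
  rw [mem_preimage, mem_ball_zero_iff]
  rw [mem_ball_zero_iff] at hx
  calc ‖v - x‖ ≤ ‖v‖ + ‖x‖ := norm_sub_le _ _
    _ < R + R := add_lt_add hv hx
    _ = _ := by ring

theorem enorm_rpow_neg_le_of_le {r s c : ℝ} (hc : 0 ≤ c) (hr : 0 ≤ r) (h : r ≤ |s|) :
    ‖s‖ₑ ^ (-c) ≤ ‖r‖ₑ ^ (-c) := by
  rw [ENNReal.rpow_neg, ENNReal.rpow_neg, ENNReal.inv_le_inv]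
  refine ENNReal.rpow_le_rpow ?_ hc
  rw [Real.enorm_eq_ofReal_abs, Real.enorm_eq_ofReal_abs, abs_of_nonneg hr]
  exact ENNReal.ofReal_le_ofReal h

/-- Split at `y = v/2`. Above it, `y^(-a) ≤ (v/2)^(-a)`. Below it, `|v - y|` is at least `v/2` and
at least `y`: the first bounds a factor `|v - y|^(-a)`, the second bounds the remaining `|v -
y|^(-(β-a))`, and the powers of `y` recombine to `y^(-β)`. -/
theorem enorm_rpow_mul_enorm_sub_rpow_le {a β v y : ℝ} (ha : 0 ≤ a) (hβ : a ≤ β) (hv : 0 < v)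
    (hy : 0 < y) :
    ‖y‖ₑ ^ (-a) * ‖v - y‖ₑ ^ (-β) ≤ ‖v / 2‖ₑ ^ (-a) * (‖v - y‖ₑ ^ (-β) + ‖y‖ₑ ^ (-β)) := by
  rcases le_total (v / 2) y with h | h
  · refine mul_le_mul' (enorm_rpow_neg_le_of_le ha (by positivity) (h.trans (le_abs_self _)))
      le_self_add
  · have h1 : v / 2 ≤ |v - y| := le_trans (by linarith) (le_abs_self _)
    have h2 : y ≤ |v - y| := h.trans h1
    have hsplit (t : ℝ) (ht : t ≠ 0) : ‖t‖ₑ ^ (-β) = ‖t‖ₑ ^ (-a) * ‖t‖ₑ ^ (-(β - a)) := by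
      rw [← ENNReal.rpow_add _ _ (by simpa using ht) (by simp)]
      congr 1; ring
    calc ‖y‖ₑ ^ (-a) * ‖v - y‖ₑ ^ (-β)
        = ‖y‖ₑ ^ (-a) * (‖v - y‖ₑ ^ (-a) * ‖v - y‖ₑ ^ (-(β - a))) := by
          rw [← hsplit _ (abs_pos.1 (hy.trans_le h2))]
      _ ≤ ‖y‖ₑ ^ (-a) * (‖v / 2‖ₑ ^ (-a) * ‖y‖ₑ ^ (-(β - a))) := by
          gcongr ?_ * (?_ * ?_)
          · exact le_rfl
          · exact enorm_rpow_neg_le_of_le ha (by positivity) h1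
          · exact enorm_rpow_neg_le_of_le (by linarith) hy.le h2
      _ = ‖v / 2‖ₑ ^ (-a) * ‖y‖ₑ ^ (-β) := by rw [hsplit y hy.ne']; ring
      _ ≤ _ := by gcongr; exact le_add_self

theorem lintegral_ball_radial {E : Type*} [NormedAddCommGroup E]
    [NormedSpace ℝ E] [Nontrivial E] [FiniteDimensional ℝ E] [MeasurableSpace E] [BorelSpace E]
    (μ : Measure E) [μ.IsAddHaarMeasure] (R a : ℝ) {g : ℝ → ℝ≥0∞} (hg : Measurable g) :
    ∫⁻ x in Metric.ball 0 R, ‖x‖ₑ ^ (-((Module.finrank ℝ E - 1 : ℕ) + a)) * g ‖x‖ ∂μ =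
      μ.toSphere univ * ∫⁻ y in Ioo 0 R, ‖y‖ₑ ^ (-a) * g y := by
  set n := Module.finrank ℝ E - 1 with hn
  have h := lintegral_fun_norm_addHaar μ
    (f := (Iio R).indicator fun y => ‖y‖ₑ ^ (-((n : ℝ) + a)) * g y)
    (Measurable.indicator (by fun_prop) measurableSet_Iio)
  rw [← lintegral_indicator Metric.isOpen_ball.measurableSet]
  refine Eq.trans (lintegral_congr fun x => ?_) (h.trans ?_)
  · by_cases hx : ‖x‖ < R <;> simp [indicator, hx]
  · rw [← hn, ← lintegral_indicator measurableSet_Ioi, ← lintegral_indicator measurableSet_Ioo]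
    congr 1
    refine lintegral_congr fun y => ?_
    by_cases hy : 0 < y
    · by_cases hyR : y < R
      · have h0 : ‖y‖ₑ ≠ 0 := by simpa using hy.ne'
        have h1 : ENNReal.ofReal (y ^ n) = ‖y‖ₑ ^ (n : ℝ) := by
          rw [ENNReal.rpow_natCast, ← enorm_pow, Real.enorm_of_nonneg (by positivity)]
        rw [indicator_of_mem (show y ∈ Ioi (0 : ℝ) from hy),
          indicator_of_mem (show y ∈ Iio R from hyR), indicator_of_mem (show y ∈ Ioo 0 R from
          ⟨hy, hyR⟩), h1, ← mul_assoc, ← ENNReal.rpow_add _ _ h0 (by simp)]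
        congr 2; ring
      · simp [indicator, hyR]
    · simp [indicator, hy]

/-- After polar coordinates and the splitting at `v/2`, only integrals of `|·|^(-β)` with `β < 1`
remain; they are bounded uniformly in `v`. -/
theorem exists_lintegral_ball_radial_le {E : Type*} [NormedAddCommGroup E]
    [NormedSpace ℝ E] [Nontrivial E] [FiniteDimensional ℝ E] [MeasurableSpace E] [BorelSpace E]
    (μ : Measure E) [μ.IsAddHaarMeasure] (R : ℝ) {a β : ℝ} (ha : 0 ≤ a) (hβ : a ≤ β)
    (hβ1 : β < 1) :
    ∃ C : ℝ≥0∞, C ≠ ⊤ ∧ ∀ v, 0 < v → v < R →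
      ∫⁻ x in Metric.ball 0 R,
        ‖x‖ₑ ^ (-((Module.finrank ℝ E - 1 : ℕ) + a)) * ‖v - ‖x‖‖ₑ ^ (-β) ∂μ ≤
      C * ‖v / 2‖ₑ ^ (-a) := by
  refine ⟨μ.toSphere univ * ((∫⁻ x in Metric.ball (0 : ℝ) (2 * R), ‖x‖ₑ ^ (-β)) +
    ∫⁻ x in Metric.ball (0 : ℝ) R, ‖x‖ₑ ^ (-β)), ?_, fun v hv hvR => ?_⟩
  · exact ENNReal.mul_ne_top (measure_ne_top _ _) (ENNReal.add_ne_top.2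
      ⟨(lintegral_ball_enorm_rpow_lt_top hβ1 _).ne, (lintegral_ball_enorm_rpow_lt_top hβ1 _).ne⟩)
  have hsub : Ioo 0 R ⊆ Metric.ball (0 : ℝ) R := fun y hy => by
    rw [mem_ball_zero_iff, Real.norm_eq_abs, abs_of_pos hy.1]; exact hy.2
  rw [lintegral_ball_radial μ R a (g := fun y => ‖v - y‖ₑ ^ (-β)) (by fun_prop), mul_assoc,
    mul_comm _ (‖v / 2‖ₑ ^ (-a))]
  refine mul_le_mul_right (α := ℝ≥0∞) ?_ _
  calc ∫⁻ y in Ioo 0 R, ‖y‖ₑ ^ (-a) * ‖v - y‖ₑ ^ (-β)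
      ≤ ∫⁻ y in Ioo 0 R, ‖v / 2‖ₑ ^ (-a) * (‖v - y‖ₑ ^ (-β) + ‖y‖ₑ ^ (-β)) :=
        setLIntegral_mono' measurableSet_Ioo fun y hy =>
          enorm_rpow_mul_enorm_sub_rpow_le ha hβ hv hy.1
    _ ≤ ∫⁻ y in Metric.ball 0 R, ‖v / 2‖ₑ ^ (-a) * (‖v - y‖ₑ ^ (-β) + ‖y‖ₑ ^ (-β)) :=
        lintegral_mono_set hsub
    _ = ‖v / 2‖ₑ ^ (-a) * ((∫⁻ y in Metric.ball 0 R, ‖v - y‖ₑ ^ (-β)) +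
          ∫⁻ y in Metric.ball (0 : ℝ) R, ‖y‖ₑ ^ (-β)) := by
        rw [lintegral_const_mul _ (by fun_prop), lintegral_add_left (by fun_prop)]
    _ ≤ _ := by
        refine mul_le_mul_right (add_le_add_left ?_ _) _
        exact lintegral_ball_enorm_sub_rpow_le β (by rwa [abs_of_pos hv])

/-! ### Weighted integrals over a cylinder -/

namespace SliceClifford

/-- The product of two balls in `ℝ ⊕ ℝ^m`. -/
def cylinder (m : ℕ) (R : ℝ) : Set (Para m) := Metric.ball 0 R ×ˢ Metric.ball 0 R

theorem lintegral_cylinder_mul {m : ℕ} (R : ℝ) {f : ℝ → ℝ≥0∞} {g : Vec m → ℝ≥0∞}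
    (hf : Measurable f) (hg : Measurable g) :
    ∫⁻ x in cylinder m R, f x.1 * g x.2 =
      (∫⁻ t in Metric.ball 0 R, f t) * ∫⁻ v in Metric.ball 0 R, g v := by
  rw [cylinder, Measure.volume_eq_prod, ← Measure.prod_restrict,
    lintegral_prod_mul hf.aemeasurable hg.aemeasurable]

/-- A majorant of `|x̲|^{1-m} F(z, x)`, where `F` is the stem function of the Cauchy kernel. -/
noncomputable def weight {m : ℕ} (a b : ℝ) (z : ℂ) (x : Para m) : ℝ≥0∞ :=
  ‖x.2‖ₑ ^ (-((m - 1 : ℕ) : ℝ)) * (‖z.re - x.1‖ₑ ^ (-a) * ‖|z.im| - ‖x.2‖‖ₑ ^ (-b))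

/-- With `s` the exponent conjugate to `P`, the `s`-th power of the weight is a function of `x₀`
times a radial function of `x̲`. The exponents become `as = s - β` and `bs = β`, and both must be
less than 1; the radial estimate also asks for `c ≤ β`. -/
theorem exists_lintegral_weight_le {m : ℕ} (hm : 1 ≤ m) {P : ℝ} (hP : (m : ℝ) < P) (hP2 : 2 < P)
    (R : ℝ) :
    ∃ a b : ℝ, 0 < a ∧ 0 < b ∧ a + b = 1 ∧ ∃ C : ℝ≥0∞, C ≠ ⊤ ∧ ∀ z : ℂ,
      |z.re| < R → z.im ≠ 0 → |z.im| < R →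
      ∫⁻ x in cylinder m R, weight a b z x ^ (P / (P - 1)) ≤
        C * ‖z.im‖ₑ ^ (-((m - 1 : ℕ) / (P - 1) : ℝ)) := by
  have : Nontrivial (Vec m) := by
    have : Nonempty (Fin m) := ⟨⟨0, hm⟩⟩
    infer_instance
  have hP1 : 0 < P - 1 := by linarith
  set s := P / (P - 1) with hs
  set c : ℝ := (m - 1 : ℕ) / (P - 1) with hc
  have hs1 : s - 1 = 1 / (P - 1) := by rw [hs]; field_simp; ring
  have hs2 : s - 1 < 1 := by rw [hs1, div_lt_one hP1]; linarith
  have hs0 : 0 < s - 1 := by rw [hs1]; positivity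
  have hc0 : 0 ≤ c := by positivity
  have hc1 : c < 1 := by
    rw [hc, div_lt_one hP1, Nat.cast_sub hm, Nat.cast_one]; linarith
  have hcs : ((m - 1 : ℕ) : ℝ) * s = (m - 1 : ℕ) + c := by rw [hs, hc]; field_simp; ring
  -- The midpoint of the admissible interval from `max c (s - 1)` to 1, nonempty because `m < P` and
  -- `2 < P`.
  set β := (1 + max c (s - 1)) / 2 with hβ
  have hmax : max c (s - 1) < 1 := max_lt hc1 hs2
  have hβ1 : β < 1 := by rw [hβ]; linarith
  have hβm : max c (s - 1) < β := by rw [hβ]; linarith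
  have hβc : c ≤ β := (le_max_left _ _).trans hβm.le
  have hβs : s - 1 < β := (le_max_right _ _).trans_lt hβm
  have hspos : 0 < s := by linarith
  obtain ⟨C, hC, h⟩ := exists_lintegral_ball_radial_le (volume : Measure (Vec m)) R hc0 hβc hβ1
  refine ⟨(s - β) / s, β / s, div_pos (by linarith) hspos, div_pos (by linarith) hspos,
    by field_simp; ring, (∫⁻ x in Metric.ball (0 : ℝ) (2 * R), ‖x‖ₑ ^ (-(s - β))) *
      (C * ‖(2 : ℝ)⁻¹‖ₑ ^ (-c)),
    ENNReal.mul_ne_top (lintegral_ball_enorm_rpow_lt_top (by linarith) _).ne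
      (ENNReal.mul_ne_top hC (ENNReal.rpow_ne_top_of_ne_zero (by simp) (by simp))),
    fun z hre him himR => ?_⟩
  have hw (x : Para m) : weight ((s - β) / s) (β / s) z x ^ s = ‖z.re - x.1‖ₑ ^ (-(s - β)) *
      (‖x.2‖ₑ ^ (-(((m - 1 : ℕ) : ℝ) + c)) * ‖|z.im| - ‖x.2‖‖ₑ ^ (-β)) := by
    rw [weight, ENNReal.mul_rpow_of_nonneg _ _ hspos.le, ENNReal.mul_rpow_of_nonneg _ _ hspos.le,
      ← ENNReal.rpow_mul, ← ENNReal.rpow_mul, ← ENNReal.rpow_mul, neg_mul, neg_mul, neg_mul, hcs,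
      div_mul_cancel₀ _ hspos.ne', div_mul_cancel₀ _ hspos.ne']
    ring
  simp_rw [hw]
  have h1 := h |z.im| (abs_pos.2 him) himR
  rw [finrank_euclideanSpace_fin, div_eq_mul_inv, enorm_mul, ← Real.norm_eq_abs, enorm_norm,
    Real.norm_eq_abs, ENNReal.mul_rpow_of_ne_top (by simp) (by simp), mul_comm (‖z.im‖ₑ ^ (-c)), ← mul_assoc] at h1
  rw [lintegral_cylinder_mul R (f := fun t => ‖z.re - t‖ₑ ^ (-(s - β)))
    (g := fun v => ‖v‖ₑ ^ (-(((m - 1 : ℕ) : ℝ) + c)) * ‖|z.im| - ‖v‖‖ₑ ^ (-β))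
    (by fun_prop) (by fun_prop), mul_assoc]
  exact mul_le_mul' (lintegral_ball_enorm_sub_rpow_le _ hre) h1

/-- This power is exactly cancelled by the polar density. It is the `p`-th power of the growth of
the transform near the real axis. -/
theorem lintegral_cylinder_rpow_lt_top {m : ℕ} (hm : 1 ≤ m) (R : ℝ) :
    ∫⁻ x in cylinder m R, ‖x.2‖ₑ ^ (-((m - 1 : ℕ) : ℝ)) < ⊤ := by
  have : Nontrivial (Vec m) := by
    have : Nonempty (Fin m) := ⟨⟨0, hm⟩⟩
    infer_instance
  have h := lintegral_cylinder_mul R (f := fun _ => 1)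
    (g := fun v : Vec m => ‖v‖ₑ ^ (-((m - 1 : ℕ) : ℝ))) measurable_const (by fun_prop)
  have h1 := lintegral_ball_radial (volume : Measure (Vec m)) R 0 (g := fun _ => 1) measurable_const
  rw [finrank_euclideanSpace_fin] at h1
  simp only [one_mul, add_zero, mul_one, neg_zero, ENNReal.rpow_zero, lintegral_const,
    Measure.restrict_apply_univ] at h h1
  rw [h, h1]
  exact ENNReal.mul_lt_top measure_ball_lt_top
    (ENNReal.mul_lt_top (measure_lt_top _ _) measure_Ioo_lt_top)

/-! ### The domain -/

/-- A point `u + Jv` with `v < 0` is also `u + (-J)(-v)`, and `D` contains the conjugate, so the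
representative in the closed upper half plane decides membership. -/
theorem Omega_eq_preimage {m : ℕ} (hm : 1 ≤ m) {D : Set ℂ}
    (hconj : ∀ z ∈ D, starRingEnd ℂ z ∈ D) : Omega m D = halfPlane ⁻¹' D := by
  ext x
  simp only [Omega, mem_iUnion, mem_image, exists_prop, mem_preimage]
  constructor
  · rintro ⟨J, hJ, z, hz, rfl⟩
    have hn : ‖z.im • J‖ = |z.im| := by
      rw [norm_smul, mem_sphere_zero_iff_norm.1 hJ, mul_one, Real.norm_eq_abs]
    rcases le_total 0 z.im with h | h
    · convert hz using 1
      apply Complex.ext <;> simp [halfPlane, slicePoint, hn, abs_of_nonneg h]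
    · convert hconj z hz using 1
      apply Complex.ext <;> simp [halfPlane, slicePoint, hn, abs_of_nonpos h]
  · intro hx
    -- On the real axis `x̲` gives no direction, so any unit vector serves; one exists because `m ≥
    -- 1`.
    by_cases h : x.2 = 0
    · refine ⟨EuclideanSpace.basisFun (Fin m) ℝ ⟨0, hm⟩, by simp, _, hx, ?_⟩
      exact Prod.ext rfl (by simp [slicePoint, halfPlane, h])
    · refine ⟨‖x.2‖⁻¹ • x.2, ?_, _, hx, ?_⟩
      · simp [norm_smul, norm_ne_zero_iff.2 h]
      · exact Prod.ext rfl (by simp [slicePoint, halfPlane, smul_smul, norm_ne_zero_iff.2 h])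

theorem continuous_halfPlane (m : ℕ) : Continuous (halfPlane : Para m → ℂ) := by
  have h : (halfPlane : Para m → ℂ) = fun x => (x.1 : ℂ) + (‖x.2‖ : ℂ) * Complex.I := by
    funext x
    apply Complex.ext <;> simp [halfPlane]
  rw [h]
  fun_prop

theorem slicePoint_mem_Omega {m : ℕ} {D : Set ℂ} {J : Vec m} (hJ : J ∈ unitSphere m) {z : ℂ}
    (hz : z ∈ D) : slicePoint J z ∈ Omega m D :=
  mem_biUnion hJ (mem_image_of_mem _ hz)

theorem exists_mem_unitSphere {m : ℕ} (hm : 1 ≤ m) : ∃ J, J ∈ unitSphere m :=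
  ⟨EuclideanSpace.basisFun (Fin m) ℝ ⟨0, hm⟩, by simp⟩

theorem slicePoint_halfPlane {m : ℕ} {x : Para m} (hx : x.2 ≠ 0) :
    slicePoint (‖x.2‖⁻¹ • x.2) (halfPlane x) = x :=
  Prod.ext rfl (by simp [slicePoint, halfPlane, smul_smul, norm_ne_zero_iff.2 hx])

theorem inv_norm_smul_mem_unitSphere {m : ℕ} {v : Vec m} (hv : v ≠ 0) :
    ‖v‖⁻¹ • v ∈ unitSphere m := by
  simp [norm_smul, norm_ne_zero_iff.2 hv]

theorem exists_Omega_subset_cylinder {m : ℕ} {D : Set ℂ}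
    (hbdd : Bornology.IsBounded (Omega m D)) : ∃ R, Omega m D ⊆ cylinder m R := by
  obtain ⟨R, hR⟩ := hbdd.subset_ball 0
  refine ⟨R, fun x hx => ?_⟩
  have h := mem_ball_zero_iff.1 (hR hx)
  exact ⟨mem_ball_zero_iff.2 ((norm_fst_le x).trans_lt h),
    mem_ball_zero_iff.2 ((norm_snd_le x).trans_lt h)⟩

/-! ### Measurability -/

theorem measurable_inv_charPoly (m : ℕ) :
    Measurable fun y : ℂ × Para m => (charPoly y.1 y.2)⁻¹ := by
  have : Continuous fun y : ℂ × Para m => charPoly y.1 y.2 := by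
    unfold charPoly normSq
    fun_prop
  exact this.measurable.inv

theorem stronglyMeasurable_kernelStem₁ (m : ℕ) :
    StronglyMeasurable fun y : ℂ × Para m => kernelStem₁ y.1 y.2 := by
  simp_rw [kernelStem₁_eq]
  have h := measurable_inv_charPoly m
  have h1 : Measurable fun y : ℂ × Para m => ((charPoly y.1 y.2)⁻¹ * (y.1 - y.2.1)).re :=
    Complex.measurable_re.comp (h.mul (by fun_prop))
  have h2 : Measurable fun y : ℂ × Para m => ((charPoly y.1 y.2)⁻¹).re :=
    Complex.measurable_re.comp h
  exact ((h1.stronglyMeasurable.smul_const _).add (h2.stronglyMeasurable.smul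
    ((continuous_vec m).comp (by fun_prop : Continuous fun y : ℂ × Para m =>
      y.2.2)).stronglyMeasurable)).neg

theorem stronglyMeasurable_kernelStem₂ (m : ℕ) :
    StronglyMeasurable fun y : ℂ × Para m => kernelStem₂ y.1 y.2 := by
  simp_rw [kernelStem₂_eq]
  have h := measurable_inv_charPoly m
  have h1 : Measurable fun y : ℂ × Para m => ((charPoly y.1 y.2)⁻¹ * (y.1 - y.2.1)).im :=
    Complex.measurable_im.comp (h.mul (by fun_prop))
  have h2 : Measurable fun y : ℂ × Para m => ((charPoly y.1 y.2)⁻¹).im :=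
    Complex.measurable_im.comp h
  exact ((h1.stronglyMeasurable.smul_const _).add (h2.stronglyMeasurable.smul
    ((continuous_vec m).comp (by fun_prop : Continuous fun y : ℂ × Para m =>
      y.2.2)).stronglyMeasurable)).neg

theorem stronglyMeasurable_stemIntegrand {m : ℕ} {F : ℂ → Para m → Cl m}
    (hF : StronglyMeasurable fun y : ℂ × Para m => F y.1 y.2) {f : Para m → Cl m}
    (hf : StronglyMeasurable f) :
    StronglyMeasurable fun y : ℂ × Para m =>
      (‖y.2.2‖ ^ (m - 1))⁻¹ • (F y.1 y.2 * f y.2) := by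
  have h : Measurable fun y : ℂ × Para m => (‖y.2.2‖ ^ (m - 1))⁻¹ := by fun_prop
  exact h.stronglyMeasurable.smul (hF.mul (hf.comp_measurable measurable_snd))

/-- Joint measurability of the integrand in `(z, x)` makes the parameter integral measurable in `z`.
-/
theorem stronglyMeasurable_stemTransform {m : ℕ} {F : ℂ → Para m → Cl m}
    (hF : StronglyMeasurable fun y : ℂ × Para m => F y.1 y.2) (D : Set ℂ) {f : Para m → Cl m}
    (hf : StronglyMeasurable f) : StronglyMeasurable (stemTransform F D f) :=
  (stronglyMeasurable_stemIntegrand hF hf).integral_prod_right'.const_smul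
    (-(1 / (Real.pi * sphereArea m)))

/-! ### Convergence of the integrals -/

theorem enorm_inv_norm_pow {m : ℕ} {v : Vec m} (hv : v ≠ 0) (n : ℕ) :
    ‖(‖v‖ ^ n)⁻¹‖ₑ = ‖v‖ₑ ^ (-(n : ℝ)) := by
  rw [enorm_inv (pow_ne_zero _ (norm_ne_zero_iff.2 hv)), enorm_pow, enorm_norm,
    ENNReal.rpow_neg, ENNReal.rpow_natCast]

theorem exists_enorm_mul_le (m : ℕ) :
    ∃ M : ℝ≥0∞, M ≠ ⊤ ∧ ∀ a b : Cl m, ‖a * b‖ₑ ≤ M * (‖a‖ₑ * ‖b‖ₑ) := by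
  obtain ⟨C, hC, h⟩ := exists_norm_mul_le m
  refine ⟨ENNReal.ofReal C, ENNReal.ofReal_ne_top, fun a b => ?_⟩
  rw [← ofReal_norm, ← ofReal_norm, ← ofReal_norm, ← ENNReal.ofReal_mul (norm_nonneg _),
    ← ENNReal.ofReal_mul hC.le]
  exact ENNReal.ofReal_le_ofReal (h a b)

theorem abs_lt_of_mem {m : ℕ} (hm : 1 ≤ m) {D : Set ℂ} {R : ℝ}
    (hR : Omega m D ⊆ cylinder m R) {z : ℂ} (hz : z ∈ D) : |z.re| < R ∧ |z.im| < R := by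
  obtain ⟨J, hJ⟩ := exists_mem_unitSphere hm
  have h := hR (slicePoint_mem_Omega hJ hz)
  have h1 := mem_ball_zero_iff.1 h.1
  have h2 := mem_ball_zero_iff.1 h.2
  refine ⟨h1, ?_⟩
  rwa [slicePoint, norm_smul, mem_sphere_zero_iff_norm.1 hJ, mul_one] at h2

theorem im_ne_zero_of_mem {m : ℕ} (hm : 1 ≤ m) {D : Set ℂ}
    (hreal : ∀ x ∈ Omega m D, x.2 ≠ 0) {z : ℂ} (hz : z ∈ D) : z.im ≠ 0 := by
  obtain ⟨J, hJ⟩ := exists_mem_unitSphere hm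
  intro h
  exact hreal _ (slicePoint_mem_Omega hJ hz) (by simp [slicePoint, h])

/-- The integrands of both components of the stem function of the transform satisfy Hölder's
inequality with a constant that depends on `z` through a power of its imaginary part. -/
theorem exists_lintegral_stemIntegrand_le {m : ℕ} (hm : 1 ≤ m) {D : Set ℂ}
    (hΩ : MeasurableSet (Omega m D)) (hbdd : Bornology.IsBounded (Omega m D))
    (hreal : ∀ x ∈ Omega m D, x.2 ≠ 0) {p : ℝ≥0∞} (hp : max (m : ℝ≥0∞) 2 < p) (hp' : p ≠ ∞) :
    ∃ C : ℝ≥0∞, C ≠ ⊤ ∧ ∀ f : Para m → Cl m,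
      AEStronglyMeasurable f (volume.restrict (Omega m D)) → ∀ z ∈ D,
      ∫⁻ x in Omega m D, ‖(‖x.2‖ ^ (m - 1))⁻¹ • (kernelStem₁ z x * f x)‖ₑ ≤
        C * ‖z.im‖ₑ ^ (-((m - 1 : ℕ) / p.toReal : ℝ)) *
          eLpNorm f p (volume.restrict (Omega m D)) ∧
      ∫⁻ x in Omega m D, ‖(‖x.2‖ ^ (m - 1))⁻¹ • (kernelStem₂ z x * f x)‖ₑ ≤
        C * ‖z.im‖ₑ ^ (-((m - 1 : ℕ) / p.toReal : ℝ)) *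
          eLpNorm f p (volume.restrict (Omega m D)) := by
  obtain ⟨R, hR⟩ := exists_Omega_subset_cylinder hbdd
  have hmP : (m : ℝ) < p.toReal := by
    simpa using (ENNReal.toReal_lt_toReal (by simp) hp').2 ((le_max_left _ _).trans_lt hp)
  have h2P : 2 < p.toReal := by
    simpa using (ENNReal.toReal_lt_toReal (by simp) hp').2 ((le_max_right _ _).trans_lt hp)
  set P := p.toReal with hP
  have hpq : P.HolderConjugate (P / (P - 1)) :=
    (Real.holderConjugate_iff_eq_conjExponent (by linarith)).2 rfl
  have hs : 0 < P / (P - 1) := hpq.symm.pos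
  have hp0 : p ≠ 0 := (bot_le.trans_lt hp).ne'
  obtain ⟨a, b, ha, hb, hab, C, hC, hint⟩ := exists_lintegral_weight_le hm hmP h2P R
  obtain ⟨B, hB, hker⟩ := exists_enorm_kernelStem_le m ha hb hab
  obtain ⟨M, hM, hmul⟩ := exists_enorm_mul_le m
  have key (f : Para m → Cl m) (hf : AEStronglyMeasurable f (volume.restrict (Omega m D)))
      (z : ℂ) (hz : z ∈ D) (G : Para m → Cl m)
      (hG : ∀ x, ‖G x‖ₑ ≤ B * (‖z.re - x.1‖ₑ ^ (-a) * ‖|z.im| - ‖x.2‖‖ₑ ^ (-b))) :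
      ∫⁻ x in Omega m D, ‖(‖x.2‖ ^ (m - 1))⁻¹ • (G x * f x)‖ₑ ≤
        M * B * C ^ (1 / (P / (P - 1))) * ‖z.im‖ₑ ^ (-((m - 1 : ℕ) / P : ℝ)) *
          eLpNorm f p (volume.restrict (Omega m D)) := by
    have hw : Measurable (weight (m := m) a b z) := by unfold weight; fun_prop
    have h1 : (∫⁻ x in Omega m D, weight a b z x ^ (P / (P - 1))) ≤
        C * ‖z.im‖ₑ ^ (-((m - 1 : ℕ) / (P - 1) : ℝ)) :=
      (lintegral_mono_set hR).trans (hint z (abs_lt_of_mem hm hR hz).1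
        (im_ne_zero_of_mem hm hreal hz) (abs_lt_of_mem hm hR hz).2)
    calc ∫⁻ x in Omega m D, ‖(‖x.2‖ ^ (m - 1))⁻¹ • (G x * f x)‖ₑ
        ≤ ∫⁻ x in Omega m D, M * B * ((fun x => ‖f x‖ₑ) * (weight a b z : Para m → ℝ≥0∞)) x := by
          refine setLIntegral_mono_ae' hΩ (.of_forall fun x hx => ?_)
          rw [enorm_smul, enorm_inv_norm_pow (hreal x hx), Pi.mul_apply, weight]
          calc _ ≤ ‖x.2‖ₑ ^ (-((m - 1 : ℕ) : ℝ)) * (M * ((B * (‖z.re - x.1‖ₑ ^ (-a) *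
                ‖|z.im| - ‖x.2‖‖ₑ ^ (-b))) * ‖f x‖ₑ)) := by
                gcongr
                exact (hmul _ _).trans (by gcongr; exact hG x)
            _ = _ := by ring
      _ = M * B * ∫⁻ x in Omega m D, ((fun x => ‖f x‖ₑ) * (weight a b z : Para m → ℝ≥0∞)) x :=
          lintegral_const_mul' _ _ (ENNReal.mul_ne_top hM hB)
      _ ≤ M * B * ((∫⁻ x in Omega m D, ‖f x‖ₑ ^ P) ^ (1 / P) *
            (C * ‖z.im‖ₑ ^ (-((m - 1 : ℕ) / (P - 1) : ℝ))) ^ (1 / (P / (P - 1)))) := by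
          gcongr
          -- Hölder's inequality separates `f` from the kernel weight.
          refine (ENNReal.lintegral_mul_le_Lp_mul_Lq _ hpq hf.enorm hw.aemeasurable).trans ?_
          gcongr
      _ = _ := by
          have hP1 : 0 < P - 1 := by linarith
          rw [ENNReal.mul_rpow_of_nonneg _ _ (by positivity), ← ENNReal.rpow_mul,
            eLpNorm_eq_lintegral_rpow_enorm_toReal hp0 hp', ← hP]
          -- The root in Hölder's inequality lowers the exponent to `(m-1)/P`, whose `P`-fold is the
          -- integrable `m - 1`.
          have he : -((m - 1 : ℕ) / (P - 1) : ℝ) * (1 / (P / (P - 1))) = -((m - 1 : ℕ) / P) := by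
            field_simp
          rw [he]
          ring
  refine ⟨M * B * C ^ (1 / (P / (P - 1))), ENNReal.mul_ne_top (ENNReal.mul_ne_top hM hB)
    (ENNReal.rpow_ne_top_of_nonneg (by positivity) hC), fun f hf z hz => ⟨?_, ?_⟩⟩
  · exact key f hf z hz _ fun x => (hker z x).1
  · exact key f hf z hz _ fun x => (hker z x).2

theorem enorm_rpow_ne_top {t : ℝ} (ht : t ≠ 0) (c : ℝ) : ‖t‖ₑ ^ c ≠ ⊤ :=
  ENNReal.rpow_ne_top_of_ne_zero (by simpa using ht) (by simp)

theorem integrableOn_stemIntegrand {m : ℕ} (hm : 1 ≤ m) {D : Set ℂ}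
    (hΩ : MeasurableSet (Omega m D)) (hbdd : Bornology.IsBounded (Omega m D))
    (hreal : ∀ x ∈ Omega m D, x.2 ≠ 0) {p : ℝ≥0∞} (hp : max (m : ℝ≥0∞) 2 < p) (hp' : p ≠ ∞)
    {f : Para m → Cl m} (hfm : StronglyMeasurable f)
    (hf : MemLp f p (volume.restrict (Omega m D))) {z : ℂ} (hz : z ∈ D) :
    IntegrableOn (fun x => (‖x.2‖ ^ (m - 1))⁻¹ • (kernelStem₁ z x * f x)) (Omega m D) ∧
    IntegrableOn (fun x => (‖x.2‖ ^ (m - 1))⁻¹ • (kernelStem₂ z x * f x)) (Omega m D) := by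
  obtain ⟨C, hC, h⟩ := exists_lintegral_stemIntegrand_le hm hΩ hbdd hreal hp hp'
  have hfin : C * ‖z.im‖ₑ ^ (-((m - 1 : ℕ) / p.toReal : ℝ)) *
      eLpNorm f p (volume.restrict (Omega m D)) < ⊤ :=
    ENNReal.mul_lt_top (ENNReal.mul_lt_top hC.lt_top
      (enorm_rpow_ne_top (im_ne_zero_of_mem hm hreal hz) _).lt_top) hf.2
  have h1 := h f hf.1 z hz
  have hmz : Measurable fun x : Para m => (z, x) := by fun_prop
  exact ⟨⟨((stronglyMeasurable_stemIntegrand (stronglyMeasurable_kernelStem₁ m)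
      hfm).comp_measurable hmz).aestronglyMeasurable, h1.1.trans_lt hfin⟩,
    ⟨((stronglyMeasurable_stemIntegrand (stronglyMeasurable_kernelStem₂ m)
      hfm).comp_measurable hmz).aestronglyMeasurable, h1.2.trans_lt hfin⟩⟩

/-! ### The transform as a slice function -/

theorem kernel_slicePoint_mul {m : ℕ} {J : Vec m} (hJ : J ∈ unitSphere m) (z : ℂ) (x : Para m)
    (c : Cl m) :
    kernel (slicePoint J z) x * c = (2 / sphereArea m) •
      ((‖x.2‖ ^ (m - 1))⁻¹ • (kernelStem₁ z x * c) +
        vec J * ((‖x.2‖ ^ (m - 1))⁻¹ • (kernelStem₂ z x * c))) := by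
  rw [kernel, cauchyKernel_slicePoint hJ, smul_mul_assoc, add_mul, mul_smul_comm, ← smul_add,
    smul_smul, mul_assoc]
  congr 1
  rw [div_mul_eq_div_div, div_eq_mul_inv (2 / sphereArea m)]

/-- Left multiplication by a Clifford number as a continuous linear map. -/
noncomputable def mulLeftCLM {m : ℕ} (c : Cl m) : Cl m →L[ℝ] Cl m :=
  LinearMap.toContinuousLinearMap (LinearMap.mulLeft ℝ c)

theorem integrableOn_kernel_mul {m : ℕ} {D : Set ℂ} {f : Para m → Cl m} {z : ℂ}
    (h₁ : IntegrableOn (fun x => (‖x.2‖ ^ (m - 1))⁻¹ • (kernelStem₁ z x * f x)) (Omega m D))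
    (h₂ : IntegrableOn (fun x => (‖x.2‖ ^ (m - 1))⁻¹ • (kernelStem₂ z x * f x)) (Omega m D))
    {J : Vec m} (hJ : J ∈ unitSphere m) :
    IntegrableOn (fun x => kernel (slicePoint J z) x * f x) (Omega m D) := by
  simp_rw [kernel_slicePoint_mul hJ]
  exact Integrable.smul (2 / sphereArea m)
    (Integrable.add h₁ ((mulLeftCLM (vec J)).integrable_comp h₂))

/-- Left multiplication by `J` is a continuous linear map and commutes with convergent integrals.
The constants match because `(1/(2π)) (2/ω) = 1/(πω)`. -/
theorem teodorescu_slicePoint {m : ℕ} {D : Set ℂ} {f : Para m → Cl m} {z : ℂ}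
    (h₁ : IntegrableOn (fun x => (‖x.2‖ ^ (m - 1))⁻¹ • (kernelStem₁ z x * f x)) (Omega m D))
    (h₂ : IntegrableOn (fun x => (‖x.2‖ ^ (m - 1))⁻¹ • (kernelStem₂ z x * f x)) (Omega m D))
    {J : Vec m} (hJ : J ∈ unitSphere m) :
    teodorescu D f (slicePoint J z) =
      stemTransform kernelStem₁ D f z + vec J * stemTransform kernelStem₂ D f z := by
  have h3 := (mulLeftCLM (vec J)).integral_comp_comm h₂
  simp only [mulLeftCLM, LinearMap.coe_toContinuousLinearMap', LinearMap.mulLeft_apply] at h3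
  have h4 : IntegrableOn (fun x => vec J * ((‖x.2‖ ^ (m - 1))⁻¹ • (kernelStem₂ z x * f x)))
      (Omega m D) := (mulLeftCLM (vec J)).integrable_comp h₂
  simp_rw [teodorescu, kernel_slicePoint_mul hJ]
  rw [integral_smul, integral_add h₁ h4, h3, stemTransform, stemTransform, mul_smul_comm,
    ← smul_add, smul_smul]
  congr 1
  ring

theorem isStem_stemTransform {m : ℕ} (D : Set ℂ) (f : Para m → Cl m) :
    IsStem D (stemTransform kernelStem₁ D f) (stemTransform kernelStem₂ D f) := by
  refine ⟨fun z _ => ?_, fun z _ => ?_⟩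
  · simp_rw [stemTransform, kernelStem₁_conj]
  · simp_rw [stemTransform, kernelStem₂_conj, neg_mul, smul_neg, integral_neg, smul_neg]

/-- The transform depends only on the class of `f`, at every point; this is what linearity on `L^p`
classes uses. -/
theorem teodorescu_congr {m : ℕ} {D : Set ℂ} {f g : Para m → Cl m}
    (h : f =ᵐ[volume.restrict (Omega m D)] g) (q : Para m) :
    teodorescu D f q = teodorescu D g q := by
  rw [teodorescu, teodorescu]
  congr 1
  refine integral_congr_ae ?_
  filter_upwards [h] with x hx
  rw [hx]

/-- Measurability in `q` is read off the stem function and the direction `q̲/|q̲|`, which avoids the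
Clifford inverse in the kernel. -/
theorem aestronglyMeasurable_teodorescu {m : ℕ} {D : Set ℂ} (hΩ : MeasurableSet (Omega m D))
    {f : Para m → Cl m} (hfm : StronglyMeasurable f)
    (h : ∀ q ∈ Omega m D, teodorescu D f q = stemTransform kernelStem₁ D f (halfPlane q) +
      vec (‖q.2‖⁻¹ • q.2) * stemTransform kernelStem₂ D f (halfPlane q)) :
    AEStronglyMeasurable (teodorescu D f) (volume.restrict (Omega m D)) := by
  have hJ : Measurable fun q : Para m => ‖q.2‖⁻¹ • q.2 := by fun_prop
  have hz := (continuous_halfPlane m).measurable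
  refine StronglyMeasurable.aestronglyMeasurable (f := fun q =>
    stemTransform kernelStem₁ D f (halfPlane q) +
      vec (‖q.2‖⁻¹ • q.2) * stemTransform kernelStem₂ D f (halfPlane q)) ?_ |>.congr ?_
  · exact ((stronglyMeasurable_stemTransform (stronglyMeasurable_kernelStem₁ m) D
      hfm).comp_measurable hz).add
      (((continuous_vec m).comp_stronglyMeasurable hJ.stronglyMeasurable).mul
        ((stronglyMeasurable_stemTransform (stronglyMeasurable_kernelStem₂ m) D
          hfm).comp_measurable hz))
  · filter_upwards [ae_restrict_mem hΩ] with q hq using (h q hq).symm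

/-- The pointwise bound `hpt` carries the factor `|q̲|^(-(m-1)/p)`, whose `p`-th power has the
finite integral `I` over the bounded domain. -/
theorem exists_eLpNorm_teodorescu_le {m : ℕ} (hm : 1 ≤ m) {D : Set ℂ}
    (hconj : ∀ z ∈ D, starRingEnd ℂ z ∈ D)
    (hΩ : MeasurableSet (Omega m D)) (hbdd : Bornology.IsBounded (Omega m D))
    (hreal : ∀ x ∈ Omega m D, x.2 ≠ 0) {p : ℝ≥0∞} (hp : max (m : ℝ≥0∞) 2 < p) (hp' : p ≠ ∞) :
    ∃ C : ℝ≥0∞, C ≠ ⊤ ∧ ∀ f : Para m → Cl m, StronglyMeasurable f →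
      MemLp f p (volume.restrict (Omega m D)) →
      eLpNorm (teodorescu D f) p (volume.restrict (Omega m D)) ≤
        C * eLpNorm f p (volume.restrict (Omega m D)) := by
  obtain ⟨R, hR⟩ := exists_Omega_subset_cylinder hbdd
  obtain ⟨C, hC, hint⟩ := exists_lintegral_stemIntegrand_le hm hΩ hbdd hreal hp hp'
  obtain ⟨M, hM, hmul⟩ := exists_enorm_mul_le m
  let L : Vec m →L[ℝ] Cl m := LinearMap.toContinuousLinearMap vec
  have hp0 : p ≠ 0 := (bot_le.trans_lt hp).ne'
  have hP0 : 0 < p.toReal := ENNReal.toReal_pos hp0 hp'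
  set ν := volume.restrict (Omega m D) with hν
  set c : ℝ := -(1 / (Real.pi * sphereArea m)) with hc
  -- The 1 accounts for `H₁` and `M * ‖L‖ₑ` for the product `J H₂`, since `J` has norm at most that
  -- of `L`.
  set A : ℝ≥0∞ := (1 + M * ‖L‖ₑ) * (‖c‖ₑ * C) with hA
  have hAtop : A ≠ ⊤ := ENNReal.mul_ne_top
    (ENNReal.add_ne_top.2 ⟨by simp, ENNReal.mul_ne_top hM (by simp)⟩)
    (ENNReal.mul_ne_top (by simp) hC)
  set I := ∫⁻ q in Omega m D, ‖q.2‖ₑ ^ (-((m - 1 : ℕ) : ℝ)) with hI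
  have hItop : I ≠ ⊤ :=
    ((lintegral_mono_set hR).trans_lt (lintegral_cylinder_rpow_lt_top hm R)).ne
  refine ⟨A * I ^ (1 / p.toReal),
    ENNReal.mul_ne_top hAtop (ENNReal.rpow_ne_top_of_nonneg (by positivity) hItop),
    fun f hfm hf => ?_⟩
  have hpt (q : Para m) (hq : q ∈ Omega m D) : ‖teodorescu D f q‖ₑ ≤
      A * ‖q.2‖ₑ ^ (-((m - 1 : ℕ) / p.toReal : ℝ)) * eLpNorm f p ν := by
    have hq0 := hreal q hq
    have hz : halfPlane q ∈ D := by rwa [Omega_eq_preimage hm hconj] at hq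
    have hJ := inv_norm_smul_mem_unitSphere hq0
    have hi := integrableOn_stemIntegrand hm hΩ hbdd hreal hp hp' hfm hf hz
    have hb := hint f hf.1 _ hz
    have him : ‖(halfPlane q).im‖ₑ = ‖q.2‖ₑ := enorm_norm _
    rw [him] at hb
    have hst (F : ℂ → Para m → Cl m) (hF : ∫⁻ x in Omega m D,
        ‖(‖x.2‖ ^ (m - 1))⁻¹ • (F (halfPlane q) x * f x)‖ₑ ≤
          C * ‖q.2‖ₑ ^ (-((m - 1 : ℕ) / p.toReal : ℝ)) * eLpNorm f p ν) :
        ‖stemTransform F D f (halfPlane q)‖ₑ ≤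
          ‖c‖ₑ * (C * ‖q.2‖ₑ ^ (-((m - 1 : ℕ) / p.toReal : ℝ)) * eLpNorm f p ν) := by
      rw [stemTransform, enorm_smul]
      gcongr
      exact (enorm_integral_le_lintegral_enorm _).trans hF
    have hvec : ‖(vec (‖q.2‖⁻¹ • q.2) : Cl m)‖ₑ ≤ ‖L‖ₑ := by
      have h := L.le_opENorm (‖q.2‖⁻¹ • q.2)
      have h1 : ‖‖q.2‖⁻¹ • q.2‖ₑ = 1 := by
        rw [← ofReal_norm, mem_sphere_zero_iff_norm.1 hJ, ENNReal.ofReal_one]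
      rwa [h1, mul_one] at h
    have ht := teodorescu_slicePoint hi.1 hi.2 hJ
    rw [slicePoint_halfPlane hq0] at ht
    rw [ht]
    calc _ ≤ ‖stemTransform kernelStem₁ D f (halfPlane q)‖ₑ +
          M * (‖L‖ₑ * ‖stemTransform kernelStem₂ D f (halfPlane q)‖ₑ) :=
          (enorm_add_le _ _).trans (by gcongr; exact (hmul _ _).trans (by gcongr))
      _ ≤ ‖c‖ₑ * (C * ‖q.2‖ₑ ^ (-((m - 1 : ℕ) / p.toReal : ℝ)) * eLpNorm f p ν) +
          M * (‖L‖ₑ *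
            (‖c‖ₑ * (C * ‖q.2‖ₑ ^ (-((m - 1 : ℕ) / p.toReal : ℝ)) * eLpNorm f p ν))) := by
          gcongr
          · exact hst _ hb.1
          · exact hst _ hb.2
      _ = _ := by rw [hA]; ring
  rw [eLpNorm_eq_lintegral_rpow_enorm_toReal hp0 hp']
  calc (∫⁻ q, ‖teodorescu D f q‖ₑ ^ p.toReal ∂ν) ^ (1 / p.toReal)
      ≤ (∫⁻ q, (A * eLpNorm f p ν) ^ p.toReal * ‖q.2‖ₑ ^ (-((m - 1 : ℕ) : ℝ)) ∂ν) ^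
          (1 / p.toReal) := by
        refine ENNReal.rpow_le_rpow (setLIntegral_mono_ae' hΩ (.of_forall fun q hq => ?_))
          (by positivity)
        calc ‖teodorescu D f q‖ₑ ^ p.toReal
            ≤ (A * ‖q.2‖ₑ ^ (-((m - 1 : ℕ) / p.toReal : ℝ)) * eLpNorm f p ν) ^ p.toReal :=
              ENNReal.rpow_le_rpow (hpt q hq) hP0.le
          _ = _ := by
              rw [mul_right_comm, ENNReal.mul_rpow_of_nonneg _ _ hP0.le, ← ENNReal.rpow_mul,
                neg_mul, div_mul_cancel₀ _ hP0.ne']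
    _ = ((A * eLpNorm f p ν) ^ p.toReal * I) ^ (1 / p.toReal) := by
        rw [lintegral_const_mul' _ _ (ENNReal.rpow_ne_top_of_nonneg hP0.le
          (ENNReal.mul_ne_top hAtop hf.2.ne))]
    _ = _ := by
        rw [ENNReal.mul_rpow_of_nonneg _ _ (by positivity), ← ENNReal.rpow_mul,
          mul_one_div_cancel hP0.ne', ENNReal.rpow_one]
        ring

/-! ### The transform as an operator -/

/-- A linear operator on slice `L^p` functions that is given by the Teodorescu transform, if that
transform is bounded and maps slice functions to slice functions. -/
theorem exists_continuousLinearMap_teodorescu {m : ℕ} {D : Set ℂ} {p : ℝ≥0∞} [Fact (1 ≤ p)]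
    (hΩ : MeasurableSet (Omega m D))
    (hint : ∀ f : sliceLp m D p, ∀ q ∈ Omega m D,
      IntegrableOn (fun x => kernel q x * f.1 x) (Omega m D))
    (hslice : ∀ f : sliceLp m D p, IsSlice D (teodorescu D f.1))
    (hmeas : ∀ f : sliceLp m D p,
      AEStronglyMeasurable (teodorescu D f.1) (volume.restrict (Omega m D)))
    {C : ℝ≥0∞} (hC : C ≠ ⊤)
    (hle : ∀ f : sliceLp m D p, eLpNorm (teodorescu D f.1) p (volume.restrict (Omega m D)) ≤
      C * eLpNorm f.1 p (volume.restrict (Omega m D))) :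
    ∃ T : sliceLp m D p →L[ℝ] sliceLp m D p, ∀ f : sliceLp m D p,
      (T f).1 =ᵐ[volume.restrict (Omega m D)] teodorescu D f.1 := by
  have hmem (f : sliceLp m D p) : MemLp (teodorescu D f.1) p (volume.restrict (Omega m D)) :=
    ⟨hmeas f, (hle f).trans_lt (ENNReal.mul_lt_top hC.lt_top (Lp.memLp f.1).2)⟩
  let T : sliceLp m D p →ₗ[ℝ] sliceLp m D p :=
    { toFun := fun f => ⟨(hmem f).toLp, teodorescu D f.1, hslice f, (hmem f).coeFn_toLp⟩
      map_add' := fun f g => by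
        refine Subtype.ext (Lp.ext ?_)
        refine (hmem (f + g)).coeFn_toLp.trans
          (((Lp.coeFn_add _ _).trans ((hmem f).coeFn_toLp.add (hmem g).coeFn_toLp)).trans ?_).symm
        -- Additivity of the integral needs convergence, known only for `q` in the domain;
        -- homogeneity below holds at every `q`.
        filter_upwards [ae_restrict_mem hΩ] with q hq
        refine Eq.trans ?_ (teodorescu_congr (Lp.coeFn_add f.1 g.1) q).symm
        rw [Pi.add_apply, teodorescu, teodorescu, teodorescu, ← smul_add, ← integral_add (hint f q hq) (hint g q hq)]
        simp_rw [Pi.add_apply, mul_add]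
      map_smul' := fun c f => by
        refine Subtype.ext (Lp.ext ?_)
        refine (hmem (c • f)).coeFn_toLp.trans
          (((Lp.coeFn_smul _ _).trans ((hmem f).coeFn_toLp.const_smul c)).trans ?_).symm
        filter_upwards with q
        refine Eq.trans ?_ (teodorescu_congr (Lp.coeFn_smul c f.1) q).symm
        rw [Pi.smul_apply, teodorescu, teodorescu, smul_comm, ← integral_smul]
        simp_rw [Pi.smul_apply, mul_smul_comm] }
  refine ⟨T.mkContinuous C.toReal fun f => ?_, fun f => (hmem f).coeFn_toLp⟩
  change ‖(hmem f).toLp‖ ≤ C.toReal * ‖f.1‖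
  rw [Lp.norm_toLp, Lp.norm_def, ← ENNReal.toReal_mul]
  exact ENNReal.toReal_mono (ENNReal.mul_ne_top hC (Lp.memLp f.1).2.ne) (hle f)

end SliceClifford

theorem mainTheorem5 (m : ℕ) (hm : 1 ≤ m) (D : Set ℂ) (hD : IsOpen D)
    (hconj : ∀ z ∈ D, starRingEnd ℂ z ∈ D)
    (hbdd : Bornology.IsBounded (SliceClifford.Omega m D))
    (hreal : ∀ x ∈ SliceClifford.Omega m D, x.2 ≠ 0)
    (p : ℝ≥0∞) [Fact (1 ≤ p)] (hp : max (m : ℝ≥0∞) 2 < p) (hp' : p ≠ ∞) :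
    -- the slice Cauchy kernel is, in its first variable, induced by an explicit stem function
    (∀ x ∈ SliceClifford.Omega m D,
      SliceClifford.IsStem (D \ {z | SliceClifford.charPoly z x = 0})
        (fun z => SliceClifford.kernelStem₁ z x) (fun z => SliceClifford.kernelStem₂ z x) ∧
      SliceClifford.Induces (D \ {z | SliceClifford.charPoly z x = 0})
        (fun z => SliceClifford.kernelStem₁ z x) (fun z => SliceClifford.kernelStem₂ z x)
        (fun q => SliceClifford.cauchyKernel q x)) ∧
    -- the integrals that define the transform and its stem function converge, and the stem
    -- function induces the transform
    (∀ f : SliceClifford.sliceLp m D p,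
      (∀ q ∈ SliceClifford.Omega m D,
        IntegrableOn (fun x => SliceClifford.kernel q x * f.1 x) (SliceClifford.Omega m D)) ∧
      (∀ z ∈ D,
        IntegrableOn (fun x => (‖x.2‖ ^ (m - 1))⁻¹ • (SliceClifford.kernelStem₁ z x * f.1 x))
          (SliceClifford.Omega m D) ∧
        IntegrableOn (fun x => (‖x.2‖ ^ (m - 1))⁻¹ • (SliceClifford.kernelStem₂ z x * f.1 x))
          (SliceClifford.Omega m D)) ∧
      SliceClifford.IsStem D
        (SliceClifford.stemTransform SliceClifford.kernelStem₁ D f.1)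
        (SliceClifford.stemTransform SliceClifford.kernelStem₂ D f.1) ∧
      SliceClifford.Induces D
        (SliceClifford.stemTransform SliceClifford.kernelStem₁ D f.1)
        (SliceClifford.stemTransform SliceClifford.kernelStem₂ D f.1)
        (SliceClifford.teodorescu D f.1)) ∧
    -- the transform is a continuous map of the space of slice `L^p` functions to itself
    (∃ T : SliceClifford.sliceLp m D p →L[ℝ] SliceClifford.sliceLp m D p,
      ∀ f : SliceClifford.sliceLp m D p,
        (T f).1 =ᵐ[volume.restrict (SliceClifford.Omega m D)] SliceClifford.teodorescu D f.1) := by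
  open SliceClifford in
  have hΩ : MeasurableSet (Omega m D) := by
    rw [Omega_eq_preimage hm hconj]
    exact (hD.preimage (continuous_halfPlane m)).measurableSet
  have hstem (f : sliceLp m D p) (z : ℂ) (hz : z ∈ D) :=
    integrableOn_stemIntegrand hm hΩ hbdd hreal hp hp' (Lp.stronglyMeasurable f.1)
      (Lp.memLp f.1) hz
  have hker (f : sliceLp m D p) (q : Para m) (hq : q ∈ Omega m D) :
      IntegrableOn (fun x => kernel q x * f.1 x) (Omega m D) := by
    obtain ⟨J, hJ, z, hz, rfl⟩ := mem_iUnion₂.1 hq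
    exact integrableOn_kernel_mul (hstem f z hz).1 (hstem f z hz).2 hJ
  have hind (f : sliceLp m D p) : Induces D (stemTransform kernelStem₁ D f.1)
      (stemTransform kernelStem₂ D f.1) (teodorescu D f.1) := fun z hz J hJ =>
    teodorescu_slicePoint (hstem f z hz).1 (hstem f z hz).2 hJ
  obtain ⟨C, hC, hle⟩ := exists_eLpNorm_teodorescu_le hm hconj hΩ hbdd hreal hp hp'
  refine ⟨fun x _ => ⟨isStem_kernelStem _ x, induces_cauchyKernel _ x⟩,
    fun f => ⟨hker f, hstem f, isStem_stemTransform D _, hind f⟩,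
    exists_continuousLinearMap_teodorescu hΩ hker
      (fun f => ⟨_, _, isStem_stemTransform D _, hind f⟩) (fun f => ?_) hC
      fun f => hle f.1 (Lp.stronglyMeasurable f.1) (Lp.memLp f.1)⟩
  refine aestronglyMeasurable_teodorescu hΩ (Lp.stronglyMeasurable f.1) fun q hq => ?_
  have hz : halfPlane q ∈ D := by rwa [Omega_eq_preimage hm hconj] at hq
  -- Off the real axis `q` is the slice point of its own direction and its half plane
  -- representative, so the induced formula applies with measurable data.
  have h := hind f _ hz _ (inv_norm_smul_mem_unitSphere (hreal q hq))
  rwa [slicePoint_halfPlane (hreal q hq)] at h
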